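/- **Theorem (Quantitative stability of $\mathbf{P}(\mu)$).** Let $W\in\mathbb R^{s\times m}$ and $q\in\mathbb R^m$ be such that for every $t\in\mathbb R^s$ there is $y\ge 0$ with $Wy=t$ (complete recourse) and such that $W^\top v<q$ componentwise for some $v\in\mathbb R^s$ (strengthened sufficiently expensive recourse). Put $\varphi(t)=\min\{q^\top y : Wy=t,\ y\ge 0\}$ and let $d_i$ $(i\in I)$ be the finitely many extreme points of $\{v : W^\top v\le q\}$. Let $X\subseteq\mathbb R^n$ be nonempty, closed and convex, $h:\mathbb R^n\to\mathbb R$ convex, $T:\mathbb R^n\to\mathbb R^s$ linear, and $\hat h(x)=\inf\{h(\xi) : \xi\in X,\ T\xi=x\}$ for $x\in T(X)$. Assume that $T(X)$ is closed and that $\hat h$ is finite and lower semicontinuous on $T(X)$. Let $p\ge 1$, let $\mathcal M^p_s$ be the set of Borel probability measures $\mu$ on $\mathbb R^s$ with $\int\|t\|^p\,\mu(dt)<\infty$, and let $d_p$ be the $p$-th order Wasserstein distance on $\mathcal M^p_s$. For $\alpha\in(0,1]$, $x\in\mathbb R^s$ and $\mu\in\mathcal M^p_s$ let $$Q_{\alpha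 CVaR}(x,\mu)=\inf_{\eta\in\mathbb R}\Big\{\eta+\frac1\alpha\int_{\mathbb R^s}\max\{0,\varphi(z-x)-\eta\}\,\mu(dz)\Big\}.$$ Let $g:[0,1]\to[0,1]$ be continuous, increasing and concave with $g(0)=0$, $g(1)=1$, let $\nu_g$ be the probability measure on $(0,1]$ with $\nu_g((0,t])=g(t)-t\,g'(t)$ for $t\in(0,1)$ ($g'$ being the right derivative) and $\nu_g(\{1\})=\lim_{t\to1-}g'(t)$, and let $$Q_{\nu_g}(x,\mu)=\int_{(0,1]}Q_{\alpha CVaR}(x,\mu)\,\nu_g(d\alpha),\qquad \Psi_g(\mu)=\operatorname{Argmin}\{\hat h(x)+Q_{\nu_g}(x,\mu) : x\in T(X)\}.$$ Assume that $$\mathcal L:=\int_{(0,1]}\frac{1}{\alpha^{1/p}}\,\nu_g(d\alpha)<\infty .$$ Let $\kappa>0$ and let $\mu_0\in\mathcal M^p_s$ be such that $Q_{\nu_g}(\cdot,\mu_0)$ is $\kappa$-strongly convex on some open convex set $V\subseteq\mathbb R^s$ with $\Psi_g(\mu_0)\cap V\neq\emptyset$. Then there is a constant $r>0$ such that for every $\mu\in\mathcal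 M^p_s$ with $d_p(\mu_0,\mu)\le r$ the set $\Psi_g(\mu)$ is nonempty and the Hausdorff distance satisfies $$d_H(\Psi_g(\mu_0),\Psi_g(\mu))\le 2\sqrt{\frac{\mathcal L\cdot\max_{i\in I}\|d_i\|}{\kappa}\,d_p(\mu_0,\mu)} .$$ -/

import Mathlib

open Set Filter Topology MeasureTheory
open scoped ENNReal

noncomputable section

namespace TwoStage

/-! ### Linear recourse -/

/-- Complete recourse: for every `t` there is `y ≥ 0` with `W y = t`. -/
def CompleteRecourse {s m : ℕ} (W : Matrix (Fin s) (Fin m) ℝ) : Prop :=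
  ∀ t : EuclideanSpace ℝ (Fin s), ∃ y : Fin m → ℝ, 0 ≤ y ∧ W.mulVec y = t.ofLp

/-- Strengthened sufficiently expensive recourse: `Wᵀ v < q` (componentwise) for some `v`. -/
def ExpensiveRecourse {s m : ℕ} (W : Matrix (Fin s) (Fin m) ℝ) (q : Fin m → ℝ) : Prop :=
  ∃ v : EuclideanSpace ℝ (Fin s), ∀ j, W.transpose.mulVec v.ofLp j < q j

/-- The value function `φ(t) = min {qᵀ y | W y = t, y ≥ 0}` of the second-stage linear program. -/
def recourse {s m : ℕ} (W : Matrix (Fin s) (Fin m) ℝ) (q : Fin m → ℝ)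
    (t : EuclideanSpace ℝ (Fin s)) : ℝ :=
  sInf {c : ℝ | ∃ y : Fin m → ℝ, 0 ≤ y ∧ W.mulVec y = t.ofLp ∧ c = dotProduct q y}

/-- The dual feasible set `{v | Wᵀ v ≤ q}`. -/
def dualPolyhedron {s m : ℕ} (W : Matrix (Fin s) (Fin m) ℝ) (q : Fin m → ℝ) :
    Set (EuclideanSpace ℝ (Fin s)) :=
  {v | ∀ j, W.transpose.mulVec v.ofLp j ≤ q j}

/-- `max_i ‖d_i‖`, where the `d_i` are the extreme points of `{v | Wᵀ v ≤ q}`. -/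
def maxVertexNorm {s m : ℕ} (W : Matrix (Fin s) (Fin m) ℝ) (q : Fin m → ℝ) : ℝ :=
  sSup ((fun d : EuclideanSpace ℝ (Fin s) => ‖d‖) '' (dualPolyhedron W q).extremePoints ℝ)

/-! ### Distortion functions and the induced measures on `(0, 1]` -/

/-- A continuous, increasing, concave distortion function on `[0, 1]`
with `g 0 = 0` and `g 1 = 1`. -/
structure IsDistortion (g : ℝ → ℝ) : Prop where
  continuousOn : ContinuousOn g (Icc 0 1)
  monotoneOn : MonotoneOn g (Icc 0 1)
  concaveOn : ConcaveOn ℝ (Icc 0 1) g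
  map_zero : g 0 = 0
  map_one : g 1 = 1

/-- The right derivative of `g`; for a concave `g` it exists at every point of `(0, 1)`, and it
is the choice of `g'` at the kinks of `g` for which `t ↦ g t - t g'(t)` is right continuous. -/
def rightSlope (g : ℝ → ℝ) (t : ℝ) : ℝ := derivWithin g (Ioi t) t

/-- The distribution function `t ↦ g t - t g'(t)` on `(0, 1)`, continued by `0` and `1`. -/
def distortionCdf (g : ℝ → ℝ) (t : ℝ) : ℝ :=
  if t ≤ 0 then 0 else if t < 1 then g t - t * rightSlope g t else 1

theorem IsDistortion.slope_le_rightSlope {g : ℝ → ℝ} (hg : IsDistortion g) {t u : ℝ}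
    (h0 : 0 < t) (htu : t < u) (h1 : u ≤ 1) : (g u - g t) / (u - t) ≤ rightSlope g t := by
  have hi : t ∈ interior (Icc (0 : ℝ) 1) := by
    rw [interior_Icc]; exact ⟨h0, htu.trans_le h1⟩
  have hd : DifferentiableWithinAt ℝ g (Ioi t) t := by
    simpa using (hg.concaveOn.neg.differentiableWithinAt_Ioi_of_mem_interior hi).neg
  have := hg.concaveOn.slope_le_rightDeriv (interior_subset hi) ⟨(h0.trans htu).le, h1⟩ htu hd
  rwa [slope_def_field] at this

theorem IsDistortion.rightSlope_le_slope {g : ℝ → ℝ} (hg : IsDistortion g) {t u : ℝ}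
    (h0 : 0 ≤ t) (htu : t < u) (h1 : u < 1) : rightSlope g u ≤ (g u - g t) / (u - t) := by
  have hi : u ∈ interior (Icc (0 : ℝ) 1) := by
    rw [interior_Icc]; exact ⟨h0.trans_lt htu, h1⟩
  have hd := (hg.concaveOn.neg.hasDerivWithinAt_rightDeriv_of_mem_interior hi).neg
  simp only [neg_neg] at hd
  have hr : rightSlope g u = -derivWithin (-g) (Ioi u) u := by
    have := hd.derivWithin (uniqueDiffWithinAt_Ioi u)
    simpa [rightSlope] using this
  have h2 := (hg.concaveOn.neg.slope_le_leftDeriv_of_mem_interior ⟨h0, (htu.trans h1).le⟩ hi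
    htu).trans (hg.concaveOn.neg.leftDeriv_le_rightDeriv_of_mem_interior hi)
  rw [slope_def_field] at h2
  simp only [Pi.neg_apply] at h2
  have h3 : (-g u - -g t) / (u - t) = -((g u - g t) / (u - t)) := by ring
  linarith

theorem IsDistortion.rightSlope_antitone {g : ℝ → ℝ} (hg : IsDistortion g) {t u : ℝ}
    (h0 : 0 < t) (htu : t < u) (h1 : u < 1) : rightSlope g u ≤ rightSlope g t :=
  (hg.rightSlope_le_slope h0.le htu h1).trans (hg.slope_le_rightSlope h0 htu h1.le)

theorem IsDistortion.rightSlope_nonneg {g : ℝ → ℝ} (hg : IsDistortion g) {t : ℝ}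
    (h0 : 0 < t) (h1 : t < 1) : 0 ≤ rightSlope g t := by
  refine le_trans ?_ (hg.slope_le_rightSlope h0 h1 le_rfl)
  have := hg.monotoneOn ⟨h0.le, h1.le⟩ ⟨zero_le_one, le_rfl⟩ h1.le
  exact div_nonneg (by linarith) (by linarith)

theorem distortionCdf_of_mem {g : ℝ → ℝ} {t : ℝ} (h0 : 0 < t) (h1 : t < 1) :
    distortionCdf g t = g t - t * rightSlope g t := by
  simp [distortionCdf, not_le.2 h0, h1]

theorem distortionCdf_of_nonpos {g : ℝ → ℝ} {t : ℝ} (h : t ≤ 0) : distortionCdf g t = 0 := by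
  simp [distortionCdf, h]

theorem distortionCdf_of_one_le {g : ℝ → ℝ} {t : ℝ} (h : 1 ≤ t) : distortionCdf g t = 1 := by
  simp [distortionCdf, not_le.2 (zero_lt_one.trans_le h), not_lt.2 h]

theorem IsDistortion.cdf_nonneg {g : ℝ → ℝ} (hg : IsDistortion g) {t : ℝ}
    (h0 : 0 < t) (h1 : t < 1) : 0 ≤ distortionCdf g t := by
  have h := hg.rightSlope_le_slope le_rfl h0 h1
  rw [hg.map_zero, sub_zero, sub_zero, le_div_iff₀ h0] at h
  rw [distortionCdf_of_mem h0 h1]; linarith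

theorem IsDistortion.cdf_le {g : ℝ → ℝ} (hg : IsDistortion g) {t : ℝ}
    (h0 : 0 < t) (h1 : t < 1) : distortionCdf g t ≤ g t := by
  rw [distortionCdf_of_mem h0 h1]
  have := mul_nonneg h0.le (hg.rightSlope_nonneg h0 h1); linarith

theorem IsDistortion.monotone_cdf {g : ℝ → ℝ} (hg : IsDistortion g) :
    Monotone (distortionCdf g) := by
  intro t u htu
  rcases htu.eq_or_lt with rfl | htu
  · exact le_rfl
  rcases le_or_gt t 0 with ht | ht
  · rw [distortionCdf_of_nonpos ht]
    rcases le_or_gt u 0 with hu | hu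
    · rw [distortionCdf_of_nonpos hu]
    rcases le_or_gt 1 u with hu1 | hu1
    · rw [distortionCdf_of_one_le hu1]; exact zero_le_one
    · exact hg.cdf_nonneg hu hu1
  rcases le_or_gt 1 u with hu1 | hu1
  · rw [distortionCdf_of_one_le hu1]
    rcases le_or_gt 1 t with ht1 | ht1
    · rw [distortionCdf_of_one_le ht1]
    · have := hg.monotoneOn ⟨ht.le, ht1.le⟩ ⟨zero_le_one, le_rfl⟩ ht1.le
      rw [hg.map_one] at this
      exact (hg.cdf_le ht ht1).trans this
  · rw [distortionCdf_of_mem ht (htu.trans hu1), distortionCdf_of_mem (ht.trans htu) hu1]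
    have h1 := hg.rightSlope_le_slope ht.le htu hu1
    rw [le_div_iff₀ (by linarith)] at h1
    have h2 := mul_le_mul_of_nonneg_left (hg.rightSlope_antitone ht htu hu1) ht.le
    nlinarith

theorem IsDistortion.rightSlope_rightCont {g : ℝ → ℝ} (hg : IsDistortion g) {t : ℝ}
    (h0 : 0 < t) (h1 : t < 1) : ContinuousWithinAt (rightSlope g) (Ioi t) t := by
  have hgt : Tendsto g (𝓝[>] t) (𝓝 (g t)) :=
    (hg.continuousOn.continuousAt (Icc_mem_nhds h0 h1)).tendsto.mono_left nhdsWithin_le_nhds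
  have hid : Tendsto (fun x : ℝ => x) (𝓝[>] t) (𝓝 t) := tendsto_id.mono_left nhdsWithin_le_nhds
  have hev : ∀ᶠ x in 𝓝[>] t, x ∈ Ioo t 1 := Ioo_mem_nhdsGT h1
  refine tendsto_order.2 ⟨fun a ha => ?_, fun a ha => ?_⟩
  · have hi : t ∈ interior (Icc (0 : ℝ) 1) := by rw [interior_Icc]; exact ⟨h0, h1⟩
    have hd : HasDerivWithinAt g (rightSlope g t) (Ioi t) t := by
      have : DifferentiableWithinAt ℝ g (Ioi t) t := by
        simpa using (hg.concaveOn.neg.differentiableWithinAt_Ioi_of_mem_interior hi).neg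
      exact this.hasDerivWithinAt
    have hs := (hasDerivWithinAt_iff_tendsto_slope' self_notMem_Ioi).1 hd
    obtain ⟨u, hua, hu⟩ := ((hs.eventually (lt_mem_nhds ha)).and hev).exists
    rw [slope_def_field] at hua
    have hc : Tendsto (fun x => (g u - g x) / (u - x)) (𝓝[>] t) (𝓝 ((g u - g t) / (u - t))) :=
      (tendsto_const_nhds.sub hgt).div (tendsto_const_nhds.sub hid) (by linarith [hu.1])
    have hxu : ∀ᶠ x in 𝓝[>] t, x ∈ Ioo t u := Ioo_mem_nhdsGT hu.1
    filter_upwards [hc.eventually (lt_mem_nhds hua), hxu] with x hx hx2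
    exact hx.trans_le (hg.slope_le_rightSlope (h0.trans hx2.1) hx2.2 hu.2.le)
  · filter_upwards [hev] with x hx
    exact (hg.rightSlope_antitone h0 hx.1 hx.2).trans_lt ha

theorem IsDistortion.cdf_rightCont {g : ℝ → ℝ} (hg : IsDistortion g) (t : ℝ) :
    ContinuousWithinAt (distortionCdf g) (Ici t) t := by
  rw [← continuousWithinAt_Ioi_iff_Ici]
  rcases lt_or_ge t 0 with ht | ht
  · have : distortionCdf g =ᶠ[𝓝[>] t] fun _ => 0 := by
      filter_upwards [Ioo_mem_nhdsGT ht] with x hx using distortionCdf_of_nonpos hx.2.le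
    exact continuousWithinAt_const.congr_of_eventuallyEq this (distortionCdf_of_nonpos ht.le)
  rcases le_or_gt 1 t with ht1 | ht1
  · have : distortionCdf g =ᶠ[𝓝[>] t] fun _ => 1 := by
      filter_upwards [self_mem_nhdsWithin] with x hx
      exact distortionCdf_of_one_le (ht1.trans (le_of_lt hx))
    exact continuousWithinAt_const.congr_of_eventuallyEq this (distortionCdf_of_one_le ht1)
  rcases ht.eq_or_lt with rfl | ht
  · have hg0 : Tendsto g (𝓝[>] 0) (𝓝 0) := by
      have := (hg.continuousOn 0 ⟨le_rfl, zero_le_one⟩).mono_of_mem_nhdsWithin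
        (mem_of_superset (Ioo_mem_nhdsGT ht1) Ioo_subset_Icc_self : Icc (0 : ℝ) 1 ∈ 𝓝[>] 0)
      simpa [ContinuousWithinAt, hg.map_zero] using this
    have hev : ∀ᶠ x in 𝓝[>] (0 : ℝ), x ∈ Ioo (0 : ℝ) 1 := Ioo_mem_nhdsGT ht1
    rw [ContinuousWithinAt, distortionCdf_of_nonpos le_rfl]
    refine tendsto_of_tendsto_of_tendsto_of_le_of_le' tendsto_const_nhds hg0 ?_ ?_
    · filter_upwards [hev] with x hx using hg.cdf_nonneg hx.1 hx.2
    · filter_upwards [hev] with x hx using hg.cdf_le hx.1 hx.2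
  · have hev : distortionCdf g =ᶠ[𝓝[>] t] fun x => g x - x * rightSlope g x := by
      filter_upwards [Ioo_mem_nhdsGT ht1] with x hx
      exact distortionCdf_of_mem (ht.trans hx.1) hx.2
    have hgt : ContinuousWithinAt g (Ioi t) t :=
      (hg.continuousOn.continuousAt (Icc_mem_nhds ht ht1)).continuousWithinAt
    exact (hgt.sub (continuousWithinAt_id.mul (hg.rightSlope_rightCont ht ht1))).congr_of_eventuallyEq
      hev (distortionCdf_of_mem ht ht1)

/-- The measure `ν_g`, i.e. the Borel measure with distribution function `distortionCdf g`. -/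
def distortionMeasure (g : ℝ → ℝ) (hg : IsDistortion g) : Measure ℝ :=
  StieltjesFunction.measure ⟨distortionCdf g, hg.monotone_cdf, hg.cdf_rightCont⟩

/-- `ν_g` is a probability measure. -/
theorem isProbabilityMeasure_distortionMeasure (g : ℝ → ℝ) (hg : IsDistortion g) :
    IsProbabilityMeasure (distortionMeasure g hg) := by
  refine StieltjesFunction.isProbabilityMeasure _ ?_ ?_
  · refine tendsto_const_nhds.congr' ?_
    filter_upwards [eventually_le_atBot 0] with x hx using (distortionCdf_of_nonpos hx).symm
  · refine tendsto_const_nhds.congr' ?_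
    filter_upwards [eventually_ge_atTop 1] with x hx using (distortionCdf_of_one_le hx).symm

/-- `ν_g` is concentrated on `(0, 1]`. -/
theorem distortionMeasure_Ioc_zero_one (g : ℝ → ℝ) (hg : IsDistortion g) :
    distortionMeasure g hg (Ioc 0 1) = 1 := by
  rw [distortionMeasure, StieltjesFunction.measure_Ioc]
  change ENNReal.ofReal (distortionCdf g 1 - distortionCdf g 0) = 1
  rw [distortionCdf_of_one_le le_rfl, distortionCdf_of_nonpos le_rfl]; simp

/-- `ν_g (0, t] = g t - t g'(t)` for `t ∈ (0, 1)`. -/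
theorem distortionMeasure_Ioc (g : ℝ → ℝ) (hg : IsDistortion g) {t : ℝ} (h0 : 0 < t)
    (h1 : t < 1) :
    distortionMeasure g hg (Ioc 0 t) = ENNReal.ofReal (g t - t * rightSlope g t) := by
  rw [distortionMeasure, StieltjesFunction.measure_Ioc]
  change ENNReal.ofReal (distortionCdf g t - distortionCdf g 0) = _
  rw [distortionCdf_of_mem h0 h1, distortionCdf_of_nonpos le_rfl, sub_zero]

/-- `ν_g {1} = lim_{t → 1-} g'(t)`. -/
theorem tendsto_rightSlope_distortionMeasure (g : ℝ → ℝ) (hg : IsDistortion g) :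
    Tendsto (rightSlope g) (𝓝[<] 1) (𝓝 (distortionMeasure g hg {1}).toReal) := by
  have hl := hg.monotone_cdf.tendsto_leftLim 1
  have hev : ∀ᶠ x in 𝓝[<] (1 : ℝ), x ∈ Ioo (0 : ℝ) 1 := Ioo_mem_nhdsLT zero_lt_one
  have hg1 : Tendsto g (𝓝[<] 1) (𝓝 1) := by
    have := (hg.continuousOn 1 ⟨zero_le_one, le_rfl⟩).mono_of_mem_nhdsWithin
      (mem_of_superset (Ioo_mem_nhdsLT zero_lt_one) Ioo_subset_Icc_self :
        Icc (0 : ℝ) 1 ∈ 𝓝[<] 1)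
    simpa [ContinuousWithinAt, hg.map_one] using this
  have hid : Tendsto (fun x : ℝ => x) (𝓝[<] 1) (𝓝 1) := tendsto_id.mono_left nhdsWithin_le_nhds
  have hle := hg.monotone_cdf.leftLim_le (le_refl 1)
  rw [distortionCdf_of_one_le le_rfl] at hle
  have hm : (distortionMeasure g hg {1}).toReal = 1 - Function.leftLim (distortionCdf g) 1 := by
    rw [distortionMeasure, StieltjesFunction.measure_singleton]
    change (ENNReal.ofReal (distortionCdf g 1 - Function.leftLim (distortionCdf g) 1)).toReal = _
    rw [distortionCdf_of_one_le le_rfl, ENNReal.toReal_ofReal (by linarith)]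
  rw [hm]
  have := (hg1.sub hl).div hid one_ne_zero
  rw [div_one] at this
  refine this.congr' ?_
  filter_upwards [hev] with x hx
  have hx0 : x ≠ 0 := hx.1.ne'
  simp only [Pi.div_apply]
  rw [distortionCdf_of_mem hx.1 hx.2]
  field_simp
  ring

/-! ### Measures with finite moments and the Wasserstein distance -/

/-- `μ ∈ 𝓜_s^p`: `μ` is a Borel probability measure on `ℝ^s` with `∫ ‖t‖^p dμ < ∞`. -/
def HasMoment {s : ℕ} (p : ℝ) (μ : Measure (EuclideanSpace ℝ (Fin s))) : Prop :=
  IsProbabilityMeasure μ ∧ Integrable (fun t => ‖t‖ ^ p) μ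

/-- The Wasserstein distance of order `p`, with values in `[0, ∞]`. -/
def wasserstein {s : ℕ} (p : ℝ) (μ μ' : Measure (EuclideanSpace ℝ (Fin s))) : ℝ≥0∞ :=
  (⨅ (γ : Measure (EuclideanSpace ℝ (Fin s) × EuclideanSpace ℝ (Fin s)))
    (_ : γ.map Prod.fst = μ ∧ γ.map Prod.snd = μ'), ∫⁻ z, ‖z.1 - z.2‖ₑ ^ p ∂γ) ^ (1 / p)

/-! ### Risk functionals and the optimisation problem -/

/-- `Q_{α CVaR}(x, μ) = min_η η + α⁻¹ ∫ max {0, φ(z - x) - η} μ(dz)` for `α ∈ (0, 1]`; for `α = 1`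
the infimum equals the expectation but need not be attained. -/
def cvar {s m : ℕ} (W : Matrix (Fin s) (Fin m) ℝ) (q : Fin m → ℝ) (α : ℝ)
    (x : EuclideanSpace ℝ (Fin s)) (μ : Measure (EuclideanSpace ℝ (Fin s))) : ℝ :=
  ⨅ η : ℝ, (η + 1 / α * ∫ z, max 0 (recourse W q (z - x) - η) ∂μ)

/-- `Q_ν(x, μ) = ∫_{(0,1]} Q_{α CVaR}(x, μ) ν(dα)`. -/
def mixedCvar {s m : ℕ} (W : Matrix (Fin s) (Fin m) ℝ) (q : Fin m → ℝ) (ν : Measure ℝ)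
    (x : EuclideanSpace ℝ (Fin s)) (μ : Measure (EuclideanSpace ℝ (Fin s))) : ℝ :=
  ∫ α in Ioc (0 : ℝ) 1, cvar W q α x μ ∂ν

/-- `{h ξ | ξ ∈ X, T ξ = x}`. -/
def firstStageCosts {n s : ℕ} (X : Set (EuclideanSpace ℝ (Fin n)))
    (h : EuclideanSpace ℝ (Fin n) → ℝ)
    (T : EuclideanSpace ℝ (Fin n) →ₗ[ℝ] EuclideanSpace ℝ (Fin s))
    (x : EuclideanSpace ℝ (Fin s)) : Set ℝ :=
  h '' {ξ | ξ ∈ X ∧ T ξ = x}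

/-- `ĥ(x) = min {h ξ | T ξ = x, ξ ∈ X}`. -/
def hHat {n s : ℕ} (X : Set (EuclideanSpace ℝ (Fin n))) (h : EuclideanSpace ℝ (Fin n) → ℝ)
    (T : EuclideanSpace ℝ (Fin n) →ₗ[ℝ] EuclideanSpace ℝ (Fin s))
    (x : EuclideanSpace ℝ (Fin s)) : ℝ :=
  sInf (firstStageCosts X h T x)

/-- `Argmin_x {ĥ(x) + Q_ν(x, μ) | x ∈ T(X)}`. -/
def solutionSet {n s m : ℕ} (W : Matrix (Fin s) (Fin m) ℝ) (q : Fin m → ℝ)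
    (X : Set (EuclideanSpace ℝ (Fin n))) (h : EuclideanSpace ℝ (Fin n) → ℝ)
    (T : EuclideanSpace ℝ (Fin n) →ₗ[ℝ] EuclideanSpace ℝ (Fin s))
    (ν : Measure ℝ) (μ : Measure (EuclideanSpace ℝ (Fin s))) :
    Set (EuclideanSpace ℝ (Fin s)) :=
  {x | x ∈ T '' X ∧ ∀ y ∈ T '' X,
    hHat X h T x + mixedCvar W q ν x μ ≤ hHat X h T y + mixedCvar W q ν y μ}

end TwoStage

end

/-! The solution set is controlled by two independent facts: the objective moves by at most `ε = 𝓛 ·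
max ‖dᵢ‖ · d_p(μ₀, μ)`, uniformly in `x`, and the unperturbed objective grows quadratically around
its minimiser.

Uniform closeness. By linear programming duality `φ` is the support function of the compact
polyhedron `{v | Wᵀ v ≤ q}`, and the norm on this polyhedron is bounded by its value at extreme
points (Krein–Milman); hence `φ` is Lipschitz with constant `max ‖dᵢ‖` (`recourse_le_add_norm`). A
coupling places both costs on one probability space, where CVaR at level `α` is Lipschitz in `L^p`
with constant `α ^ (-1/p)` (`avar_le_avar_add`). Integration over `ν_g` turns this factor into `𝓛`
(`abs_mixedCvar_sub_le`).

Growth. Strong convexity of the risk term on `V` and convexity of `ĥ` give growth `κ / 2 * ‖x - x₀‖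
^ 2` on a ball in `V` (`quadratic_growth_of_strongConvexOn`). Convexity of the perturbed objective
carries this local information to all of `T(X)`: a small perturbation cannot create minimisers
outside the ball. Inside it, a minimiser satisfies `κ / 2 * ‖x - x₀‖ ^ 2 ≤ 2 * ε`
(`minimizers_of_quadratic_growth`). -/

namespace TwoStage

/-! ### The average value at risk of a random variable -/

/-- The average value at risk `min_η η + α⁻¹ ∫ max {0, Y - η} dP`. -/
noncomputable def avar {Ω : Type*} [MeasurableSpace Ω] (P : Measure Ω) (α : ℝ) (Y : Ω → ℝ) : ℝ :=
  ⨅ η : ℝ, (η + 1 / α * ∫ z, max 0 (Y z - η) ∂P)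

section Avar

variable {Ω : Type*} [MeasurableSpace Ω] {P : Measure Ω} {α : ℝ} {Y Y₁ Y₂ Δ : Ω → ℝ}

theorem integral_excess_nonneg (Y : Ω → ℝ) (η : ℝ) : 0 ≤ ∫ z, max 0 (Y z - η) ∂P :=
  integral_nonneg fun _ => le_max_left _ _

theorem avar_map {Ω' : Type*} [MeasurableSpace Ω'] {Q : Measure Ω'} {f : Ω' → Ω}
    (hf : Measurable f) (hY : Measurable Y) (α : ℝ) :
    avar (Q.map f) α Y = avar Q α (Y ∘ f) := by
  unfold avar
  congr 1 with η
  rw [integral_map hf.aemeasurable (by fun_prop)]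
  rfl

variable [IsProbabilityMeasure P]

theorem integrable_excess (hY : Integrable Y P) (η : ℝ) :
    Integrable (fun z => max 0 (Y z - η)) P := by
  simp only [max_comm (0 : ℝ)]
  exact (hY.sub (integrable_const η)).pos_part

/-- Since `1 / α ≥ 1`, the mean lies below every term of the infimum. This lower bound makes the
real-valued `⨅` in `avar` a genuine infimum. -/
theorem integral_le_add_excess (h0 : 0 < α) (h1 : α ≤ 1) (hY : Integrable Y P) (η : ℝ) :
    ∫ z, Y z ∂P ≤ η + 1 / α * ∫ z, max 0 (Y z - η) ∂P := by
  have h2 : ∫ z, (Y z - η) ∂P ≤ ∫ z, max 0 (Y z - η) ∂P :=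
    integral_mono (hY.sub (integrable_const η)) (integrable_excess hY η) fun _ => le_max_right _ _
  rw [integral_sub hY (integrable_const η)] at h2
  have h3 : 1 * ∫ z, max 0 (Y z - η) ∂P ≤ 1 / α * ∫ z, max 0 (Y z - η) ∂P :=
    mul_le_mul_of_nonneg_right ((one_le_div h0).2 h1) (integral_excess_nonneg _ _)
  simp only [integral_const, probReal_univ, smul_eq_mul, one_mul] at h2 h3
  linarith

theorem avar_le (h0 : 0 < α) (h1 : α ≤ 1) (hY : Integrable Y P) (η : ℝ) :
    avar P α Y ≤ η + 1 / α * ∫ z, max 0 (Y z - η) ∂P :=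
  ciInf_le ⟨∫ z, Y z ∂P, forall_mem_range.2 (integral_le_add_excess h0 h1 hY)⟩ η

theorem integral_le_avar (h0 : 0 < α) (h1 : α ≤ 1) (hY : Integrable Y P) :
    ∫ z, Y z ∂P ≤ avar P α Y :=
  le_ciInf (integral_le_add_excess h0 h1 hY)

/-- Supplies measurability in `α` when CVaR is integrated over levels. -/
theorem avar_antitone (hY : Integrable Y P) : AntitoneOn (fun α => avar P α Y) (Ioc 0 1) := by
  intro α hα β hβ hαβ
  change avar P β Y ≤ avar P α Y
  refine le_ciInf fun η => (avar_le hβ.1 hβ.2 hY η).trans ?_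
  gcongr
  exact hα.1

theorem avar_convex (h0 : 0 < α) (h1 : α ≤ 1) (hY₁ : Integrable Y₁ P) (hY₂ : Integrable Y₂ P)
    (hY : Integrable Y P) {a b : ℝ} (ha : 0 ≤ a) (hb : 0 ≤ b) (hab : a + b = 1)
    (hle : ∀ z, Y z ≤ a * Y₁ z + b * Y₂ z) :
    avar P α Y ≤ a * avar P α Y₁ + b * avar P α Y₂ := by
  -- Near-optimal `η₁`, `η₂` are used because the infimum need not be attained at `α = 1`.
  refine le_of_forall_pos_le_add fun δ hδ => ?_
  obtain ⟨η₁, h₁⟩ := exists_lt_of_ciInf_lt (lt_add_of_pos_right (avar P α Y₁) hδ)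
  obtain ⟨η₂, h₂⟩ := exists_lt_of_ciInf_lt (lt_add_of_pos_right (avar P α Y₂) hδ)
  have h3 : ∫ z, max 0 (Y z - (a * η₁ + b * η₂)) ∂P ≤
      a * ∫ z, max 0 (Y₁ z - η₁) ∂P + b * ∫ z, max 0 (Y₂ z - η₂) ∂P := by
    rw [← integral_const_mul, ← integral_const_mul,
      ← integral_add ((integrable_excess hY₁ _).const_mul _) ((integrable_excess hY₂ _).const_mul _)]
    refine integral_mono (integrable_excess hY _)
      (((integrable_excess hY₁ _).const_mul _).add ((integrable_excess hY₂ _).const_mul _))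
      fun z => max_le ?_ ?_
    · exact add_nonneg (mul_nonneg ha (le_max_left _ _)) (mul_nonneg hb (le_max_left _ _))
    · have e1 := mul_le_mul_of_nonneg_left (le_max_right 0 (Y₁ z - η₁)) ha
      have e2 := mul_le_mul_of_nonneg_left (le_max_right 0 (Y₂ z - η₂)) hb
      have e3 := hle z
      linarith
  have h4 := avar_le h0 h1 hY (a * η₁ + b * η₂)
  have h5 := mul_le_mul_of_nonneg_left h3 (one_div_pos.2 h0).le
  have h6 := mul_le_mul_of_nonneg_left h₁.le ha
  have h7 := mul_le_mul_of_nonneg_left h₂.le hb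
  have h8 : a * δ + b * δ = δ := by rw [← add_mul, hab, one_mul]
  linarith

/-- The tangent line of `y ↦ y ^ p` at `c`. -/
theorem le_const_add_rpow {p c y : ℝ} (hp : 1 ≤ p) (hc : 0 < c) (hy : 0 ≤ y) :
    y ≤ (1 - 1 / p) * c + c / p / c ^ p * y ^ p := by
  have h := one_add_mul_self_le_rpow_one_add (s := y / c - 1) (by
    have := div_nonneg hy hc.le
    linarith) hp
  rw [add_sub_cancel, Real.div_rpow hy hc.le] at h
  have hp0 : 0 < p := by linarith
  have h2 := mul_le_mul_of_nonneg_left h (div_pos hc hp0).le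
  have e1 : c / p * (1 + p * (y / c - 1)) = y - (1 - 1 / p) * c := by
    field_simp
    ring
  have e2 : c / p * (y ^ p / c ^ p) = c / p / c ^ p * y ^ p := by ring
  linarith

/-- The tangent line of `y ↦ y ^ p` at `c` bounds `Δ` by a constant `(1 - 1 / p) * c` plus a
multiple of `Δ ^ p`. The constant is absorbed by shifting `η`; after division by `α` the multiple of
`Δ ^ p` integrates to at most `c / p`. The two contributions add up to `c`, with no appeal to Hölder
or to a dual form of CVaR. -/
theorem avar_le_avar_add {p c : ℝ} (hp : 1 ≤ p) (h0 : 0 < α) (h1 : α ≤ 1) (hc : 0 ≤ c)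
    (hY₁ : Integrable Y₁ P) (hY₂ : Integrable Y₂ P) (hΔ0 : ∀ z, 0 ≤ Δ z)
    (hle : ∀ z, Y₂ z ≤ Y₁ z + Δ z) (hΔ : Integrable (fun z => Δ z ^ p) P)
    (hΔc : ∫ z, Δ z ^ p ∂P ≤ α * c ^ p) :
    avar P α Y₂ ≤ avar P α Y₁ + c := by
  refine le_of_forall_pos_le_add fun δ hδ => ?_
  -- `c` may vanish, while the tangent line needs a positive base point.
  set d := c + δ with hd
  have hd0 : 0 < d := by positivity
  have hdp : 0 < d ^ p := Real.rpow_pos_of_pos hd0 p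
  have hp0 : 0 < p := by linarith
  have hΔd : ∫ z, Δ z ^ p ∂P ≤ α * d ^ p :=
    hΔc.trans (mul_le_mul_of_nonneg_left (Real.rpow_le_rpow hc (by linarith) hp0.le) h0.le)
  have key : avar P α Y₂ - d ≤ avar P α Y₁ := by
    refine le_ciInf fun η => ?_
    have h2 := avar_le h0 h1 hY₂ (η + (1 - 1 / p) * d)
    have h3 : ∫ z, max 0 (Y₂ z - (η + (1 - 1 / p) * d)) ∂P ≤
        ∫ z, max 0 (Y₁ z - η) ∂P + d / p / d ^ p * ∫ z, Δ z ^ p ∂P := by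
      rw [← integral_const_mul, ← integral_add (integrable_excess hY₁ _) (hΔ.const_mul _)]
      refine integral_mono (integrable_excess hY₂ _)
        ((integrable_excess hY₁ _).add (hΔ.const_mul _)) fun z => max_le ?_ ?_
      · exact add_nonneg (le_max_left _ _)
          (mul_nonneg (by positivity) (Real.rpow_nonneg (hΔ0 z) p))
      · have e1 := le_max_right 0 (Y₁ z - η)
        have e2 := le_const_add_rpow hp hd0 (hΔ0 z)
        have e3 := hle z
        linarith
    have h4 := mul_le_mul_of_nonneg_left hΔd (by positivity : 0 ≤ d / p / d ^ p)
    have h5 : d / p / d ^ p * (α * d ^ p) = α * (d / p) := by field_simp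
    have h6 := mul_le_mul_of_nonneg_left (h3.trans (add_le_add_right (h4.trans h5.le) _))
      (one_div_pos.2 h0).le
    have h7 : 1 / α * (∫ z, max 0 (Y₁ z - η) ∂P + α * (d / p)) =
        1 / α * ∫ z, max 0 (Y₁ z - η) ∂P + d / p := by field_simp
    have h8 : (1 - 1 / p) * d + d / p = d := by ring
    linarith
  linarith

/-- Source of the factor `α ^ (-1/p)`: it solves `α * c ^ p = C ^ p` for `c`. -/
theorem mul_rpow_neg_one_div_mul_rpow {α p C : ℝ} (h0 : 0 < α) (hp : 0 < p) (hC : 0 ≤ C) :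
    α * (α ^ (-(1 / p)) * C) ^ p = C ^ p := by
  rw [Real.mul_rpow (Real.rpow_nonneg h0.le _) hC, ← Real.rpow_mul h0.le]
  have : -(1 / p) * p = -1 := by field_simp
  rw [this, Real.rpow_neg_one, ← mul_assoc, mul_inv_cancel₀ h0.ne', one_mul]

theorem avar_le_rpow {p C : ℝ} (hp : 1 ≤ p) (h0 : 0 < α) (h1 : α ≤ 1) (hC : 0 ≤ C)
    (hY : Integrable Y P) (hYp : Integrable (fun z => |Y z| ^ p) P)
    (hYC : ∫ z, |Y z| ^ p ∂P ≤ C ^ p) : avar P α Y ≤ α ^ (-(1 / p)) * C := by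
  have h2 := avar_le_avar_add (Y₁ := fun _ => 0) (Δ := fun z => |Y z|)
    (c := α ^ (-(1 / p)) * C) hp h0 h1
    (mul_nonneg (Real.rpow_nonneg h0.le _) hC) (integrable_const 0) hY (fun z => abs_nonneg _)
    (fun z => by simpa using le_abs_self (Y z)) hYp ?_
  · have h3 : avar P α (fun _ => 0) ≤ 0 := by
      simpa using avar_le (P := P) h0 h1 (integrable_const 0) 0
    linarith
  · rw [mul_rpow_neg_one_div_mul_rpow h0 (by linarith) hC]
    exact hYC

end Avar

/-! ### The value function of the second-stage problem -/

section Recourse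

variable {s m : ℕ} {W : Matrix (Fin s) (Fin m) ℝ} {q : Fin m → ℝ}

theorem inner_le_of_mem_dualPolyhedron {v t : EuclideanSpace ℝ (Fin s)}
    (hv : v ∈ dualPolyhedron W q) {y : Fin m → ℝ} (hy : 0 ≤ y) (hWy : W.mulVec y = t.ofLp) :
    inner ℝ v t ≤ dotProduct q y := by
  have h1 : inner ℝ v t = dotProduct (W.transpose.mulVec v.ofLp) y := by
    rw [EuclideanSpace.inner_eq_star_dotProduct, ← hWy, Matrix.mulVec_transpose,
      ← Matrix.dotProduct_mulVec, dotProduct_comm]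
    simp
  rw [h1]
  exact Finset.sum_le_sum fun j _ => mul_le_mul_of_nonneg_right (hv j) (hy j)

theorem ExpensiveRecourse.nonempty (hq : ExpensiveRecourse W q) : (dualPolyhedron W q).Nonempty :=
  hq.imp fun _ hv j => (hv j).le

theorem recourse_le (hq : ExpensiveRecourse W q) {t : EuclideanSpace ℝ (Fin s)} {y : Fin m → ℝ}
    (hy : 0 ≤ y) (hWy : W.mulVec y = t.ofLp) : recourse W q t ≤ dotProduct q y := by
  obtain ⟨v, hv⟩ := hq.nonempty
  refine csInf_le ⟨inner ℝ v t, ?_⟩ ⟨y, hy, hWy, rfl⟩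
  rintro c ⟨y, hy, hWy, rfl⟩
  exact inner_le_of_mem_dualPolyhedron hv hy hWy

theorem le_recourse (hW : CompleteRecourse W) {t : EuclideanSpace ℝ (Fin s)} {c : ℝ}
    (h : ∀ y : Fin m → ℝ, 0 ≤ y → W.mulVec y = t.ofLp → c ≤ dotProduct q y) :
    c ≤ recourse W q t := by
  obtain ⟨y, hy, hWy⟩ := hW t
  refine le_csInf ⟨_, y, hy, hWy, rfl⟩ ?_
  rintro _ ⟨y, hy, hWy, rfl⟩
  exact h y hy hWy

theorem inner_le_recourse (hW : CompleteRecourse W) {v : EuclideanSpace ℝ (Fin s)}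
    (hv : v ∈ dualPolyhedron W q) (t : EuclideanSpace ℝ (Fin s)) :
    inner ℝ v t ≤ recourse W q t :=
  le_recourse hW fun _ hy hWy => inner_le_of_mem_dualPolyhedron hv hy hWy

theorem recourse_add_le (hW : CompleteRecourse W) (hq : ExpensiveRecourse W q)
    (t u : EuclideanSpace ℝ (Fin s)) :
    recourse W q (t + u) ≤ recourse W q t + recourse W q u := by
  rw [← sub_le_iff_le_add]
  refine le_recourse hW fun y hy hWy => ?_
  rw [sub_le_comm]
  refine le_recourse hW fun z hz hWz => ?_
  have := recourse_le (t := t + u) hq (add_nonneg hy hz)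
    (by rw [Matrix.mulVec_add, hWy, hWz]; rfl)
  rw [dotProduct_add] at this
  linarith

theorem recourse_smul_le (hW : CompleteRecourse W) (hq : ExpensiveRecourse W q) {c : ℝ}
    (hc : 0 < c) (t : EuclideanSpace ℝ (Fin s)) :
    recourse W q (c • t) ≤ c * recourse W q t := by
  rw [← div_le_iff₀' hc]
  refine le_recourse hW fun y hy hWy => ?_
  rw [div_le_iff₀' hc]
  have := recourse_le (t := c • t) hq (smul_nonneg hc.le hy)
    (by rw [Matrix.mulVec_smul, hWy]; rfl)
  rwa [dotProduct_smul, smul_eq_mul] at this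

theorem recourse_zero_le (hq : ExpensiveRecourse W q) : recourse W q 0 ≤ 0 := by
  have := recourse_le (t := (0 : EuclideanSpace ℝ (Fin s))) hq (le_refl (0 : Fin m → ℝ)) (by simp)
  rwa [dotProduct_zero] at this

theorem recourse_smul (hW : CompleteRecourse W) (hq : ExpensiveRecourse W q) {c : ℝ}
    (hc : 0 < c) (t : EuclideanSpace ℝ (Fin s)) :
    recourse W q (c • t) = c * recourse W q t := by
  refine (recourse_smul_le hW hq hc t).antisymm ?_
  have := recourse_smul_le hW hq (inv_pos.2 hc) (c • t)
  rwa [inv_smul_smul₀ hc.ne', ← div_eq_inv_mul, le_div_iff₀' hc] at this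

theorem convexOn_recourse (hW : CompleteRecourse W) (hq : ExpensiveRecourse W q) :
    ConvexOn ℝ univ (recourse W q) := by
  refine convexOn_iff_forall_pos.2 ⟨convex_univ, fun t _ u _ a b ha hb _ => ?_⟩
  exact (recourse_add_le hW hq _ _).trans
    (add_le_add (recourse_smul_le hW hq ha t) (recourse_smul_le hW hq hb u))

/-- Strong duality for the second-stage problem. -/
theorem exists_recourse_eq_inner (hW : CompleteRecourse W) (hq : ExpensiveRecourse W q)
    (t : EuclideanSpace ℝ (Fin s)) :
    ∃ v ∈ dualPolyhedron W q, recourse W q t = inner ℝ v t := by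
  have h0 : 0 ≤ recourse W q 0 := by
    obtain ⟨v, hv⟩ := hq.nonempty
    simpa using inner_le_recourse hW hv 0
  -- By Riesz, a linear functional dominated by `φ` and equal to it at `t` is an optimal dual
  -- vector. Hahn–Banach provides one because `φ` is sublinear.
  suffices H : ∃ f : EuclideanSpace ℝ (Fin s) →ₗ[ℝ] ℝ,
      f t = recourse W q t ∧ ∀ x, f x ≤ recourse W q x by
    obtain ⟨f, hft, hf⟩ := H
    refine ⟨(InnerProductSpace.toDual ℝ _).symm (LinearMap.toContinuousLinearMap f),
      fun j => ?_, ?_⟩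
    -- Dual feasibility is tested on the columns of `W`: `f (W eⱼ) ≤ φ (W eⱼ) ≤ qⱼ`.
    · have h1 := hf (WithLp.toLp 2 (W.mulVec (Pi.single j 1)))
      have h2 := recourse_le (t := WithLp.toLp 2 (W.mulVec (Pi.single j 1))) hq
        (Pi.single_nonneg.2 zero_le_one : (0 : Fin m → ℝ) ≤ Pi.single j 1) rfl
      rw [dotProduct_single_one] at h2
      refine le_trans (le_of_eq ?_) (h1.trans h2)
      set v := (InnerProductSpace.toDual ℝ _).symm (LinearMap.toContinuousLinearMap f) with hv
      have h3 : f (WithLp.toLp 2 (W.mulVec (Pi.single j 1))) =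
          inner ℝ v (WithLp.toLp 2 (W.mulVec (Pi.single j 1))) := by
        rw [hv, InnerProductSpace.toDual_symm_apply]
        rfl
      rw [h3, EuclideanSpace.inner_eq_star_dotProduct, Matrix.mulVec_transpose]
      simp only [star_trivial]
      rw [dotProduct_comm, Matrix.dotProduct_mulVec, dotProduct_single_one]
    · rw [InnerProductSpace.toDual_symm_apply]
      exact hft.symm
  by_cases ht : t = 0
  · subst ht
    obtain ⟨v, hv⟩ := hq.nonempty
    refine ⟨(InnerProductSpace.toDual ℝ _ v).toLinearMap, ?_, fun x => inner_le_recourse hW hv x⟩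
    rw [map_zero]
    exact h0.antisymm (recourse_zero_le hq)
  obtain ⟨f, hf1, hf2⟩ := exists_extension_of_le_sublinear
    (LinearPMap.mkSpanSingleton (K := ℝ) t (recourse W q t) ht) (recourse W q)
    (fun c hc x => recourse_smul hW hq hc x) (recourse_add_le hW hq) (by
      rintro ⟨x, hx⟩
      obtain ⟨c, rfl⟩ := Submodule.mem_span_singleton.1 hx
      change LinearPMap.mkSpanSingleton' t (recourse W q t) _ ⟨c • t, hx⟩ ≤ recourse W q (c • t)
      rw [LinearPMap.mkSpanSingleton'_apply]
      change c * recourse W q t ≤ recourse W q (c • t)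
      rcases lt_trichotomy c 0 with hc | rfl | hc
      -- For negative `c`, domination follows from `0 ≤ φ 0 ≤ φ (c • t) + φ (-c • t)`.
      · have h1 := recourse_add_le hW hq (c • t) ((-c) • t)
        rw [recourse_smul hW hq (neg_pos.2 hc), ← add_smul, add_neg_cancel, zero_smul] at h1
        linarith
      · simpa using h0
      · exact (recourse_smul hW hq hc t).ge)
  refine ⟨f, ?_, hf2⟩
  have := hf1 ⟨t, Submodule.mem_span_singleton_self t⟩
  rw [this]
  exact LinearPMap.mkSpanSingleton_apply ℝ ℝ ht (recourse W q t)

/-- Complete recourse writes each `± eᵢ` as `W y` with `y ≥ 0`; weak duality then bounds `± vᵢ` by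
`qᵀ y`. -/
theorem isCompact_dualPolyhedron (hW : CompleteRecourse W) : IsCompact (dualPolyhedron W q) := by
  refine Metric.isCompact_of_isClosed_isBounded ?_ ?_
  · have : dualPolyhedron W q = ⋂ j, {v | W.transpose.mulVec v.ofLp j ≤ q j} := by
      ext; simp [dualPolyhedron]
    rw [this]
    refine isClosed_iInter fun j => isClosed_le ?_ continuous_const
    simp only [Matrix.mulVec, dotProduct]
    fun_prop
  · have hb : ∀ i : Fin s, ∃ c, ∀ v ∈ dualPolyhedron W q, |v i| ≤ c := fun i => by
      obtain ⟨y, hy, hWy⟩ := hW (EuclideanSpace.single i 1)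
      obtain ⟨z, hz, hWz⟩ := hW (-EuclideanSpace.single i 1)
      refine ⟨max (dotProduct q y) (dotProduct q z), fun v hv => abs_le'.2 ⟨?_, ?_⟩⟩
      · simpa [EuclideanSpace.inner_single_right] using
          Or.inl (b := v i ≤ dotProduct q z) (inner_le_of_mem_dualPolyhedron hv hy hWy)
      · simpa [EuclideanSpace.inner_single_right] using
          Or.inr (a := -v i ≤ dotProduct q y) (inner_le_of_mem_dualPolyhedron hv hz hWz)
    choose c hc using hb
    refine isBounded_iff_forall_norm_le.2 ⟨√(∑ i, c i ^ 2), fun v hv => ?_⟩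
    rw [EuclideanSpace.norm_eq]
    exact Real.sqrt_le_sqrt (Finset.sum_le_sum fun i _ =>
      pow_le_pow_left₀ (norm_nonneg _) (hc i v hv) 2)

theorem convex_dualPolyhedron : Convex ℝ (dualPolyhedron W q) := by
  intro v hv u hu a b ha hb hab j
  have h1 := mul_le_mul_of_nonneg_left (hv j) ha
  have h2 := mul_le_mul_of_nonneg_left (hu j) hb
  have h3 : a * q j + b * q j = q j := by rw [← add_mul, hab, one_mul]
  simp only [WithLp.ofLp_add, WithLp.ofLp_smul, Matrix.mulVec_add, Matrix.mulVec_smul,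
    Pi.add_apply, Pi.smul_apply, smul_eq_mul]
  linarith

theorem maxVertexNorm_nonneg : 0 ≤ maxVertexNorm W q :=
  Real.sSup_nonneg (by rintro _ ⟨v, -, rfl⟩; exact norm_nonneg v)

/-- By Krein–Milman the polyhedron is the closed convex hull of its extreme points, so a closed ball
containing these contains all of it. -/
theorem norm_le_maxVertexNorm (hW : CompleteRecourse W) {v : EuclideanSpace ℝ (Fin s)}
    (hv : v ∈ dualPolyhedron W q) : ‖v‖ ≤ maxVertexNorm W q := by
  have hc := isCompact_dualPolyhedron (q := q) hW
  obtain ⟨C, hC⟩ := isBounded_iff_forall_norm_le.1 hc.isBounded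
  rw [← closure_convexHull_extremePoints hc convex_dualPolyhedron] at hv
  have hsub : closure (convexHull ℝ ((dualPolyhedron W q).extremePoints ℝ)) ⊆
      Metric.closedBall 0 (maxVertexNorm W q) := by
    refine closure_minimal (convexHull_min (fun d hd => ?_) (convex_closedBall _ _))
      Metric.isClosed_closedBall
    rw [mem_closedBall_zero_iff]
    refine le_csSup ⟨C, ?_⟩ ⟨d, hd, rfl⟩
    rintro _ ⟨u, hu, rfl⟩
    exact hC u (extremePoints_subset hu)
  simpa using hsub hv

theorem recourse_le_norm (hW : CompleteRecourse W) (hq : ExpensiveRecourse W q)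
    (t : EuclideanSpace ℝ (Fin s)) : recourse W q t ≤ maxVertexNorm W q * ‖t‖ := by
  obtain ⟨v, hv, hvt⟩ := exists_recourse_eq_inner hW hq t
  rw [hvt]
  exact (real_inner_le_norm v t).trans
    (mul_le_mul_of_nonneg_right (norm_le_maxVertexNorm hW hv) (norm_nonneg t))

theorem recourse_le_add_norm (hW : CompleteRecourse W) (hq : ExpensiveRecourse W q)
    (t u : EuclideanSpace ℝ (Fin s)) :
    recourse W q t ≤ recourse W q u + maxVertexNorm W q * ‖t - u‖ := by
  have h1 := recourse_add_le hW hq u (t - u)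
  rw [add_sub_cancel] at h1
  linarith [recourse_le_norm hW hq (t - u)]

theorem abs_recourse_le (hW : CompleteRecourse W) (hq : ExpensiveRecourse W q)
    (t : EuclideanSpace ℝ (Fin s)) : |recourse W q t| ≤ maxVertexNorm W q * ‖t‖ := by
  refine abs_le.2 ⟨?_, recourse_le_norm hW hq t⟩
  obtain ⟨v, hv⟩ := hq.nonempty
  have h1 := recourse_le_add_norm hW hq 0 t
  have h2 := inner_le_recourse hW hv 0
  rw [zero_sub, norm_neg] at h1
  rw [inner_zero_right] at h2
  linarith

theorem continuous_recourse (hW : CompleteRecourse W) (hq : ExpensiveRecourse W q) :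
    Continuous (recourse W q) := by
  refine (LipschitzWith.of_le_add_mul ⟨maxVertexNorm W q, maxVertexNorm_nonneg⟩
    fun t u => ?_).continuous
  rw [dist_eq_norm]
  exact recourse_le_add_norm hW hq t u

end Recourse

/-! ### Stability of minimisers of convex functions -/

/-- If `F₀` grows quadratically around its minimiser `x₀` and the convex function `F` is uniformly
close to `F₀`, then `F` has minimisers, all of them near `x₀`. -/
theorem minimizers_of_quadratic_growth {E : Type*} [NormedAddCommGroup E] [NormedSpace ℝ E]
    [ProperSpace E] {C : Set E} (hC : IsClosed C) {F₀ F : E → ℝ} (hF : ConvexOn ℝ C F)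
    (hlsc : LowerSemicontinuousOn F C) {x₀ : E} (hx₀ : x₀ ∈ C) {ρ κ ε : ℝ} (hρ : 0 < ρ)
    (hκ : 0 < κ)
    (hgrowth : ∀ x ∈ C, x ∈ Metric.closedBall x₀ ρ → F₀ x₀ + κ / 2 * ‖x - x₀‖ ^ 2 ≤ F₀ x)
    (hclose : ∀ x ∈ C, |F x - F₀ x| ≤ ε) (hε : 4 * ε < κ * ρ ^ 2) :
    {x | x ∈ C ∧ ∀ y ∈ C, F x ≤ F y}.Nonempty ∧
      ∀ x ∈ {x | x ∈ C ∧ ∀ y ∈ C, F x ≤ F y}, ‖x - x₀‖ ≤ 2 * √(ε / κ) := by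
  have hgrow : ∀ x ∈ C, x ∈ Metric.closedBall x₀ ρ →
      F x₀ + κ / 2 * ‖x - x₀‖ ^ 2 ≤ F x + 2 * ε := fun x hx hxb => by
    have h1 := abs_le.1 (hclose x hx)
    have h2 := abs_le.1 (hclose x₀ hx₀)
    linarith [hgrowth x hx hxb, h1.1, h2.2]
  -- A point outside the ball is compared with the point of the segment to `x₀` at distance `ρ`.
  -- There `F` exceeds `F x₀`, as `4 * ε < κ * ρ ^ 2`, and convexity propagates the strict increase
  -- outwards.
  have hfar : ∀ x ∈ C, ρ < ‖x - x₀‖ → F x₀ < F x := fun x hx hxρ => by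
    have hpos : 0 < ‖x - x₀‖ := hρ.trans hxρ
    set b := ρ / ‖x - x₀‖ with hb
    have hb0 : 0 < b := div_pos hρ hpos
    have hb1 : b < 1 := (div_lt_one hpos).2 hxρ
    have hyC := hF.1 hx₀ hx (sub_pos.2 hb1).le hb0.le (by ring)
    have hyc := hF.2 hx₀ hx (sub_pos.2 hb1).le hb0.le (by ring)
    have hy : ‖((1 - b) • x₀ + b • x) - x₀‖ = ρ := by
      have : ((1 - b) • x₀ + b • x) - x₀ = b • (x - x₀) := by module
      rw [this, norm_smul, Real.norm_of_nonneg hb0.le, hb, div_mul_cancel₀ _ hpos.ne']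
    have h1 := hgrow _ hyC (by rw [Metric.mem_closedBall, dist_eq_norm, hy])
    rw [hy] at h1
    simp only [smul_eq_mul] at hyc
    nlinarith
  have hK : IsCompact (C ∩ Metric.closedBall x₀ ρ) :=
    (isCompact_closedBall x₀ ρ).inter_left hC
  obtain ⟨x₁, hx₁, hmin⟩ := LowerSemicontinuousOn.exists_isMinOn (s := C ∩ Metric.closedBall x₀ ρ)
    ⟨x₀, hx₀, Metric.mem_closedBall_self hρ.le⟩ hK (hlsc.mono inter_subset_left)
  constructor
  · refine ⟨x₁, hx₁.1, fun y hy => ?_⟩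
    rcases le_or_gt ‖y - x₀‖ ρ with h | h
    · exact hmin ⟨hy, by rwa [Metric.mem_closedBall, dist_eq_norm]⟩
    · exact (isMinOn_iff.1 hmin x₀ ⟨hx₀, Metric.mem_closedBall_self hρ.le⟩).trans
        (hfar y hy h).le
  · rintro x ⟨hx, hxm⟩
    have hxρ : ‖x - x₀‖ ≤ ρ := le_of_not_gt fun h => (hfar x hx h).not_ge (hxm x₀ hx₀)
    have h1 := hgrow x hx (by rwa [Metric.mem_closedBall, dist_eq_norm])
    have h2 := hxm x₀ hx₀
    have h3 : (‖x - x₀‖ / 2) ^ 2 ≤ ε / κ := by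
      rw [le_div_iff₀ hκ]
      nlinarith
    have h4 := Real.le_sqrt_of_sq_le h3
    linarith

/-- Strong convexity of one summand near a minimiser gives quadratic growth there. -/
theorem quadratic_growth_of_strongConvexOn {E : Type*} [NormedAddCommGroup E] [NormedSpace ℝ E]
    {C V : Set E} {f Q : E → ℝ} {κ : ℝ} (hf : ConvexOn ℝ C f) (hQ : StrongConvexOn V κ Q)
    {x₀ : E} (hx₀ : x₀ ∈ C) (hx₀V : x₀ ∈ V) (hmin : ∀ y ∈ C, f x₀ + Q x₀ ≤ f y + Q y)
    {x : E} (hx : x ∈ C) (hxV : x ∈ V) :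
    f x₀ + Q x₀ + κ / 2 * ‖x - x₀‖ ^ 2 ≤ f x + Q x := by
  -- Minimality at `(1 - b) • x₀ + b • x`, combined with both convexity inequalities and divided by
  -- `b`, leaves the factor `1 - b`, which is removed by letting `b` tend to `0`.
  have key : ∀ b ∈ Ioo (0 : ℝ) 1,
      f x₀ + Q x₀ + (1 - b) * (κ / 2 * ‖x - x₀‖ ^ 2) ≤ f x + Q x := fun b hb => by
    have h1 := hf.2 hx₀ hx (sub_pos.2 hb.2).le hb.1.le (by ring)
    have h2 := hQ.2 hx₀V hxV (sub_pos.2 hb.2).le hb.1.le (by ring)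
    have h3 := hmin _ (hf.1 hx₀ hx (sub_pos.2 hb.2).le hb.1.le (by ring))
    rw [norm_sub_rev] at h2
    simp only [smul_eq_mul] at h1 h2
    refine le_of_mul_le_mul_left ?_ hb.1
    linarith
  have hlim : Tendsto (fun b : ℝ => f x₀ + Q x₀ + (1 - b) * (κ / 2 * ‖x - x₀‖ ^ 2)) (𝓝[>] 0)
      (𝓝 (f x₀ + Q x₀ + (1 - 0) * (κ / 2 * ‖x - x₀‖ ^ 2))) :=
    Continuous.tendsto (by fun_prop) 0 |>.mono_left nhdsWithin_le_nhds
  rw [sub_zero, one_mul] at hlim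
  refine le_of_tendsto hlim ?_
  filter_upwards [Ioo_mem_nhdsGT zero_lt_one] with b hb using key b hb

/-! ### Couplings and the risk functionals -/

section Risk

variable {s m : ℕ} {W : Matrix (Fin s) (Fin m) ℝ} {q : Fin m → ℝ} {p : ℝ}
  {μ μ' : Measure (EuclideanSpace ℝ (Fin s))}

theorem exists_coupling_of_wasserstein_lt (hp : 0 < p) {c : ℝ≥0∞} (h : wasserstein p μ μ' < c) :
    ∃ γ : Measure (EuclideanSpace ℝ (Fin s) × EuclideanSpace ℝ (Fin s)),
      γ.map Prod.fst = μ ∧ γ.map Prod.snd = μ' ∧ ∫⁻ z, ‖z.1 - z.2‖ₑ ^ p ∂γ ≤ c ^ p := by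
  have h1 := ENNReal.rpow_lt_rpow h hp
  rw [wasserstein, ← ENNReal.rpow_mul, one_div_mul_cancel hp.ne', ENNReal.rpow_one,
    iInf_lt_iff] at h1
  obtain ⟨γ, h1⟩ := h1
  obtain ⟨hγ, h1⟩ := iInf_lt_iff.1 h1
  exact ⟨γ, hγ.1, hγ.2, h1.le⟩

theorem memLp_recourse (hW : CompleteRecourse W) (hq : ExpensiveRecourse W q) (hp : 0 < p)
    (hμ : HasMoment p μ) (x : EuclideanSpace ℝ (Fin s)) :
    MemLp (fun z => recourse W q (z - x)) (ENNReal.ofReal p) μ := by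
  have := hμ.1
  have h1 : MemLp (fun z : EuclideanSpace ℝ (Fin s) => z) (ENNReal.ofReal p) μ := by
    refine (integrable_norm_rpow_iff aestronglyMeasurable_id ?_ ENNReal.ofReal_ne_top).1 ?_
    · simpa using hp
    · simpa [ENNReal.toReal_ofReal hp.le] using hμ.2
  refine (h1.sub (memLp_const x)).of_le_mul
    ((continuous_recourse hW hq).comp (continuous_id.sub continuous_const)).aestronglyMeasurable
    (Eventually.of_forall fun z => abs_recourse_le hW hq (z - x))

theorem integrable_recourse (hW : CompleteRecourse W) (hq : ExpensiveRecourse W q) (hp : 1 ≤ p)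
    (hμ : HasMoment p μ) (x : EuclideanSpace ℝ (Fin s)) :
    Integrable (fun z => recourse W q (z - x)) μ := by
  have := hμ.1
  exact (memLp_recourse hW hq (by linarith) hμ x).integrable (by simpa using hp)

theorem measurable_recourse_sub (hW : CompleteRecourse W) (hq : ExpensiveRecourse W q)
    (x : EuclideanSpace ℝ (Fin s)) : Measurable fun z => recourse W q (z - x) :=
  ((continuous_recourse hW hq).comp (continuous_id.sub continuous_const)).measurable

theorem avar_recourse_le {Ω : Type*} [MeasurableSpace Ω] {P : Measure Ω} [IsProbabilityMeasure P]
    (hW : CompleteRecourse W) (hq : ExpensiveRecourse W q) (hp : 1 ≤ p)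
    {U V : Ω → EuclideanSpace ℝ (Fin s)} (hU : Measurable U) (hV : Measurable V)
    (hφU : Integrable (fun z => recourse W q (U z)) P)
    (hφV : Integrable (fun z => recourse W q (V z)) P) {c : ℝ} (hc : 0 ≤ c)
    (hUV : ∫⁻ z, ‖U z - V z‖ₑ ^ p ∂P ≤ ENNReal.ofReal c ^ p) {α : ℝ} (h0 : 0 < α) (h1 : α ≤ 1) :
    avar P α (fun z => recourse W q (V z)) ≤
      avar P α (fun z => recourse W q (U z)) + α ^ (-(1 / p)) * (maxVertexNorm W q * c) := by
  set D := maxVertexNorm W q with hD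
  have hD0 : 0 ≤ D := maxVertexNorm_nonneg
  have hp0 : 0 < p := by linarith
  have hmeas : Measurable fun z => ‖U z - V z‖ ^ p := (hU.sub hV).norm.pow_const p
  have hnn : ∀ z, 0 ≤ ‖U z - V z‖ ^ p := fun z => Real.rpow_nonneg (norm_nonneg _) p
  have hlint : ∫⁻ z, ENNReal.ofReal (‖U z - V z‖ ^ p) ∂P ≤ ENNReal.ofReal (c ^ p) := by
    rw [← ENNReal.ofReal_rpow_of_nonneg hc hp0.le]
    refine le_trans (le_of_eq (lintegral_congr fun z => ?_)) hUV
    rw [← ofReal_norm, ENNReal.ofReal_rpow_of_nonneg (norm_nonneg _) hp0.le]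
  have hint : Integrable (fun z => ‖U z - V z‖ ^ p) P := by
    refine ⟨hmeas.aestronglyMeasurable, ?_⟩
    rw [hasFiniteIntegral_iff_ofReal (Eventually.of_forall hnn)]
    exact hlint.trans_lt ENNReal.ofReal_lt_top
  have hle : ∫ z, ‖U z - V z‖ ^ p ∂P ≤ c ^ p := by
    rw [integral_eq_lintegral_of_nonneg_ae (Eventually.of_forall hnn) hmeas.aestronglyMeasurable]
    exact ENNReal.toReal_le_of_le_ofReal (Real.rpow_nonneg hc p) hlint
  have hmul : ∀ z, (D * ‖U z - V z‖) ^ p = D ^ p * ‖U z - V z‖ ^ p := fun z =>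
    Real.mul_rpow hD0 (norm_nonneg _)
  refine avar_le_avar_add (Δ := fun z => D * ‖U z - V z‖) hp h0 h1
    (mul_nonneg (Real.rpow_nonneg h0.le _) (mul_nonneg hD0 hc)) hφU hφV
    (fun z => mul_nonneg hD0 (norm_nonneg _)) (fun z => ?_) ?_ ?_
  · rw [norm_sub_rev]
    exact recourse_le_add_norm hW hq (V z) (U z)
  · simp_rw [hmul]
    exact hint.const_mul _
  · simp_rw [hmul]
    rw [integral_const_mul, mul_rpow_neg_one_div_mul_rpow h0 hp0 (mul_nonneg hD0 hc),
      Real.mul_rpow hD0 hc]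
    exact mul_le_mul_of_nonneg_left hle (Real.rpow_nonneg hD0 p)

/-- Under a coupling `γ` both CVaRs are functionals of random variables on the same space, whose
difference is at most `max ‖dᵢ‖ * ‖z.1 - z.2‖`. The strict bound by `c` avoids the need for an
optimal coupling. -/
theorem abs_cvar_sub_le (hW : CompleteRecourse W) (hq : ExpensiveRecourse W q) (hp : 1 ≤ p)
    (hμ : HasMoment p μ) (hμ' : HasMoment p μ') {c : ℝ} (hc : 0 ≤ c)
    (h : wasserstein p μ μ' < ENNReal.ofReal c) (x : EuclideanSpace ℝ (Fin s)) {α : ℝ}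
    (h0 : 0 < α) (h1 : α ≤ 1) :
    |cvar W q α x μ' - cvar W q α x μ| ≤ α ^ (-(1 / p)) * (maxVertexNorm W q * c) := by
  obtain ⟨γ, hγ₁, hγ₂, hγ⟩ := exists_coupling_of_wasserstein_lt (by linarith) h
  have hm := measurable_recourse_sub hW hq x
  have hprob : IsProbabilityMeasure γ := by
    have := hμ.1
    rw [← hγ₁] at this
    exact Measure.isProbabilityMeasure_of_map Prod.fst
  have i₁ : Integrable (fun z : EuclideanSpace ℝ (Fin s) × EuclideanSpace ℝ (Fin s) =>
      recourse W q (z.1 - x)) γ := by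
    have := integrable_recourse hW hq hp hμ x
    rw [← hγ₁] at this
    exact this.comp_measurable measurable_fst
  have i₂ : Integrable (fun z : EuclideanSpace ℝ (Fin s) × EuclideanSpace ℝ (Fin s) =>
      recourse W q (z.2 - x)) γ := by
    have := integrable_recourse hW hq hp hμ' x
    rw [← hγ₂] at this
    exact this.comp_measurable measurable_snd
  have e₁ : cvar W q α x μ = avar γ α (fun z => recourse W q (z.1 - x)) := by
    rw [← hγ₁]
    exact avar_map measurable_fst hm α
  have e₂ : cvar W q α x μ' = avar γ α (fun z => recourse W q (z.2 - x)) := by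
    rw [← hγ₂]
    exact avar_map measurable_snd hm α
  have l₁ := avar_recourse_le hW hq hp (measurable_fst.sub_const x) (measurable_snd.sub_const x)
    i₁ i₂ hc (by simpa using hγ) h0 h1
  have l₂ := avar_recourse_le hW hq hp (measurable_snd.sub_const x) (measurable_fst.sub_const x)
    i₂ i₁ hc (by simpa [enorm_sub_rev] using hγ) h0 h1
  rw [e₁, e₂]
  exact abs_sub_le_iff.2 ⟨by linarith, by linarith⟩

theorem cvar_le_cvar_add (hW : CompleteRecourse W) (hq : ExpensiveRecourse W q) (hp : 1 ≤ p)
    (hμ : HasMoment p μ) (x y : EuclideanSpace ℝ (Fin s)) {α : ℝ} (h0 : 0 < α) (h1 : α ≤ 1) :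
    cvar W q α x μ ≤ cvar W q α y μ + α ^ (-(1 / p)) * (maxVertexNorm W q * dist x y) := by
  have := hμ.1
  refine avar_recourse_le hW hq hp (measurable_id.sub_const y) (measurable_id.sub_const x)
    (integrable_recourse hW hq hp hμ y) (integrable_recourse hW hq hp hμ x) dist_nonneg ?_ h0 h1
  simp [dist_eq_norm]

variable {ν : Measure ℝ}

/-- CVaR lies between the mean and `α ^ (-1/p)` times the `L^p` norm of the cost; finiteness of `𝓛`
makes this envelope integrable. -/
theorem integrableOn_cvar [IsFiniteMeasure ν] (hW : CompleteRecourse W)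
    (hq : ExpensiveRecourse W q) (hp : 1 ≤ p) (hμ : HasMoment p μ)
    (hL : IntegrableOn (fun α : ℝ => α ^ (-(1 / p))) (Ioc 0 1) ν)
    (x : EuclideanSpace ℝ (Fin s)) : IntegrableOn (fun α => cvar W q α x μ) (Ioc 0 1) ν := by
  have := hμ.1
  have hp0 : 0 < p := by linarith
  have hY := integrable_recourse hW hq hp hμ x
  have hYp : Integrable (fun z => |recourse W q (z - x)| ^ p) μ := by
    have := (memLp_recourse hW hq hp0 hμ x).integrable_norm_rpow'
    simpa [ENNReal.toReal_ofReal hp0.le] using this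
  set I := ∫ z, |recourse W q (z - x)| ^ p ∂μ with hI
  have hI0 : 0 ≤ I := integral_nonneg fun _ => Real.rpow_nonneg (abs_nonneg _) p
  have hIp : I ≤ (I ^ (1 / p)) ^ p := by
    rw [← Real.rpow_mul hI0, one_div_mul_cancel hp0.ne', Real.rpow_one]
  have hC : 0 ≤ I ^ (1 / p) := Real.rpow_nonneg hI0 _
  have hg : IntegrableOn (fun α : ℝ => |∫ z, recourse W q (z - x) ∂μ| + α ^ (-(1 / p)) * I ^ (1 / p))
      (Ioc 0 1) ν := (integrable_const _).add (hL.mul_const _)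
  refine Integrable.mono' hg ?_ ?_
  · exact (aemeasurable_restrict_of_antitoneOn measurableSet_Ioc
      (avar_antitone hY)).aestronglyMeasurable
  · refine (ae_restrict_iff' measurableSet_Ioc).2 (Eventually.of_forall fun α hα => ?_)
    have h1 : cvar W q α x μ ≤ _ := avar_le_rpow hp hα.1 hα.2 hC hY hYp hIp
    have h2 : _ ≤ cvar W q α x μ := integral_le_avar hα.1 hα.2 hY
    have h3 := mul_nonneg (Real.rpow_nonneg hα.1.le (-(1 / p))) hC
    refine abs_le.2 ⟨?_, ?_⟩
    · linarith [neg_abs_le (∫ z, recourse W q (z - x) ∂μ)]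
    · linarith [abs_nonneg (∫ z, recourse W q (z - x) ∂μ)]

/-- Wasserstein stability of the mixed risk functional, uniformly in the decision. -/
theorem abs_mixedCvar_sub_le [IsFiniteMeasure ν] (hW : CompleteRecourse W)
    (hq : ExpensiveRecourse W q) (hp : 1 ≤ p) (hμ : HasMoment p μ) (hμ' : HasMoment p μ')
    (hL : IntegrableOn (fun α : ℝ => α ^ (-(1 / p))) (Ioc 0 1) ν)
    (h : wasserstein p μ μ' ≠ ⊤) (x : EuclideanSpace ℝ (Fin s)) :
    |mixedCvar W q ν x μ' - mixedCvar W q ν x μ| ≤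
      (∫ α in Ioc (0 : ℝ) 1, α ^ (-(1 / p)) ∂ν) *
        (maxVertexNorm W q * (wasserstein p μ μ').toReal) := by
  have i₁ := integrableOn_cvar hW hq hp hμ hL x
  have i₂ := integrableOn_cvar hW hq hp hμ' hL x
  have key : ∀ c, (wasserstein p μ μ').toReal < c →
      |mixedCvar W q ν x μ' - mixedCvar W q ν x μ| ≤
        (∫ α in Ioc (0 : ℝ) 1, α ^ (-(1 / p)) ∂ν) * (maxVertexNorm W q * c) := fun c hc => by
    have hc0 : 0 < c := ENNReal.toReal_nonneg.trans_lt hc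
    have hlt : wasserstein p μ μ' < ENNReal.ofReal c := (ENNReal.lt_ofReal_iff_toReal_lt h).2 hc
    rw [mixedCvar, mixedCvar, ← integral_sub i₂ i₁, ← integral_mul_const, ← Real.norm_eq_abs]
    refine norm_integral_le_of_norm_le (hL.mul_const _) ?_
    exact (ae_restrict_iff' measurableSet_Ioc).2 (Eventually.of_forall fun α hα =>
      abs_cvar_sub_le hW hq hp hμ hμ' hc0.le hlt x hα.1 hα.2)
  have hlim : Tendsto (fun c : ℝ => (∫ α in Ioc (0 : ℝ) 1, α ^ (-(1 / p)) ∂ν) *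
      (maxVertexNorm W q * c)) (𝓝[>] (wasserstein p μ μ').toReal)
      (𝓝 ((∫ α in Ioc (0 : ℝ) 1, α ^ (-(1 / p)) ∂ν) *
        (maxVertexNorm W q * (wasserstein p μ μ').toReal))) :=
    (Continuous.tendsto (by fun_prop) _).mono_left nhdsWithin_le_nhds
  refine ge_of_tendsto hlim ?_
  filter_upwards [self_mem_nhdsWithin] with c hc using key c hc

theorem continuous_mixedCvar [IsFiniteMeasure ν] (hW : CompleteRecourse W)
    (hq : ExpensiveRecourse W q) (hp : 1 ≤ p) (hμ : HasMoment p μ)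
    (hL : IntegrableOn (fun α : ℝ => α ^ (-(1 / p))) (Ioc 0 1) ν) :
    Continuous fun x => mixedCvar W q ν x μ := by
  refine (LipschitzWith.of_le_add_mul'
    ((∫ α in Ioc (0 : ℝ) 1, α ^ (-(1 / p)) ∂ν) * maxVertexNorm W q) fun x y => ?_).continuous
  have i₁ := integrableOn_cvar hW hq hp hμ hL x
  have i₂ := integrableOn_cvar hW hq hp hμ hL y
  rw [mixedCvar, mixedCvar, mul_assoc, ← integral_mul_const,
    ← integral_add i₂ (hL.mul_const _)]
  exact setIntegral_mono_on i₁ (i₂.add (hL.mul_const _)) measurableSet_Ioc fun α hα =>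
    cvar_le_cvar_add hW hq hp hμ x y hα.1 hα.2

theorem convexOn_mixedCvar [IsFiniteMeasure ν] (hW : CompleteRecourse W)
    (hq : ExpensiveRecourse W q) (hp : 1 ≤ p) (hμ : HasMoment p μ)
    (hL : IntegrableOn (fun α : ℝ => α ^ (-(1 / p))) (Ioc 0 1) ν) :
    ConvexOn ℝ univ fun x => mixedCvar W q ν x μ := by
  refine ⟨convex_univ, fun x _ y _ a b ha hb hab => ?_⟩
  have := hμ.1
  have i := integrableOn_cvar hW hq hp hμ hL
  simp only [smul_eq_mul, mixedCvar]
  rw [← integral_const_mul, ← integral_const_mul,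
    ← integral_add ((i x).const_mul a) ((i y).const_mul b)]
  refine setIntegral_mono_on (i _) (((i x).const_mul a).add ((i y).const_mul b))
    measurableSet_Ioc fun α hα => ?_
  refine avar_convex hα.1 hα.2 (integrable_recourse hW hq hp hμ x)
    (integrable_recourse hW hq hp hμ y) (integrable_recourse hW hq hp hμ _) ha hb hab fun z => ?_
  have h1 := (convexOn_recourse hW hq).2 (mem_univ (z - x)) (mem_univ (z - y)) ha hb hab
  have h2 : a • (z - x) + b • (z - y) = z - (a • x + b • y) := by
    rw [smul_sub, smul_sub, sub_add_sub_comm, ← add_smul, hab, one_smul]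
  rwa [h2] at h1

end Risk

/-! ### The reduced first-stage cost -/

/-- Partial minimisation preserves convexity; near-minimisers suffice, so attainment of the infimum
plays no role. -/
theorem convexOn_hHat {n s : ℕ} {X : Set (EuclideanSpace ℝ (Fin n))} (hX : Convex ℝ X)
    {h : EuclideanSpace ℝ (Fin n) → ℝ} (hh : ConvexOn ℝ univ h)
    {T : EuclideanSpace ℝ (Fin n) →ₗ[ℝ] EuclideanSpace ℝ (Fin s)}
    (hfin : ∀ x ∈ T '' X, BddBelow (firstStageCosts X h T x)) :
    ConvexOn ℝ (T '' X) (hHat X h T) := by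
  have hconv : Convex ℝ (T '' X) := hX.linear_image T
  have happrox : ∀ x ∈ T '' X, ∀ δ > 0, ∃ ξ ∈ X, T ξ = x ∧ h ξ < hHat X h T x + δ := by
    rintro _ ⟨ξ₀, hξ₀, rfl⟩ δ hδ
    obtain ⟨_, ⟨ξ, ⟨hξ, hTξ⟩, rfl⟩, hlt⟩ := exists_lt_of_csInf_lt
      (s := firstStageCosts X h T (T ξ₀)) ⟨h ξ₀, ξ₀, ⟨hξ₀, rfl⟩, rfl⟩ (lt_add_of_pos_right _ hδ)
    exact ⟨ξ, hξ, hTξ, hlt⟩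
  refine ⟨hconv, fun x hx y hy a b ha hb hab => le_of_forall_pos_le_add fun δ hδ => ?_⟩
  obtain ⟨ξ, hξ, hTξ, hξx⟩ := happrox x hx δ hδ
  obtain ⟨ζ, hζ, hTζ, hζy⟩ := happrox y hy δ hδ
  have h1 : hHat X h T (a • x + b • y) ≤ h (a • ξ + b • ζ) :=
    csInf_le (hfin _ (hconv hx hy ha hb hab))
      ⟨_, ⟨hX hξ hζ ha hb hab, by rw [map_add, map_smul, map_smul, hTξ, hTζ]⟩, rfl⟩
  have h2 := hh.2 (mem_univ ξ) (mem_univ ζ) ha hb hab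
  have h3 := mul_le_mul_of_nonneg_left hξx.le ha
  have h4 := mul_le_mul_of_nonneg_left hζy.le hb
  have h5 : a * δ + b * δ = δ := by rw [← add_mul, hab, one_mul]
  simp only [smul_eq_mul] at h2 ⊢
  linarith

end TwoStage

/-! ### Quantitative stability of the solution set -/

theorem mainTheorem5 {n s m : ℕ}
    -- recourse data
    (W : Matrix (Fin s) (Fin m) ℝ) (q : Fin m → ℝ)
    (hW : TwoStage.CompleteRecourse W) (hq : TwoStage.ExpensiveRecourse W q)
    -- first-stage data
    (X : Set (EuclideanSpace ℝ (Fin n))) (hXne : X.Nonempty) (hXcl : IsClosed X)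
    (hXconv : Convex ℝ X)
    (h : EuclideanSpace ℝ (Fin n) → ℝ) (hh : ConvexOn ℝ Set.univ h)
    (T : EuclideanSpace ℝ (Fin n) →ₗ[ℝ] EuclideanSpace ℝ (Fin s))
    -- the reduced first-stage problem is well posed
    (hTX : IsClosed (T '' X))
    (hfin : ∀ x ∈ T '' X, BddBelow (TwoStage.firstStageCosts X h T x))
    (hlsc : LowerSemicontinuousOn (TwoStage.hHat X h T) (T '' X))
    -- the distortion function and the finite constant `∫ α^(-1/p) ν_g(dα)`
    (p : ℝ) (hp : 1 ≤ p) (g : ℝ → ℝ) (hg : TwoStage.IsDistortion g)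
    (hL : MeasureTheory.IntegrableOn (fun α : ℝ => α ^ (-(1 / p))) (Set.Ioc 0 1)
      (TwoStage.distortionMeasure g hg))
    -- the unperturbed measure
    (μ₀ : MeasureTheory.Measure (EuclideanSpace ℝ (Fin s))) (hμ₀ : TwoStage.HasMoment p μ₀)
    (κ : ℝ) (hκ : 0 < κ) (V : Set (EuclideanSpace ℝ (Fin s))) (hVopen : IsOpen V)
    (hVconv : Convex ℝ V)
    (hsc : StrongConvexOn V κ
      (fun x => TwoStage.mixedCvar W q (TwoStage.distortionMeasure g hg) x μ₀))
    (hV : (TwoStage.solutionSet W q X h T (TwoStage.distortionMeasure g hg) μ₀ ∩ V).Nonempty) :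
    ∃ r : ℝ, 0 < r ∧
      ∀ μ : MeasureTheory.Measure (EuclideanSpace ℝ (Fin s)), TwoStage.HasMoment p μ →
        TwoStage.wasserstein p μ₀ μ ≤ ENNReal.ofReal r →
        (TwoStage.solutionSet W q X h T (TwoStage.distortionMeasure g hg) μ).Nonempty ∧
        Metric.hausdorffEDist
            (TwoStage.solutionSet W q X h T (TwoStage.distortionMeasure g hg) μ₀)
            (TwoStage.solutionSet W q X h T (TwoStage.distortionMeasure g hg) μ) ≤
          ENNReal.ofReal (2 * √((∫ α in Set.Ioc (0 : ℝ) 1, α ^ (-(1 / p))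
              ∂(TwoStage.distortionMeasure g hg)) * TwoStage.maxVertexNorm W q / κ
            * (TwoStage.wasserstein p μ₀ μ).toReal)) := by
  have := TwoStage.isProbabilityMeasure_distortionMeasure g hg
  set ν := TwoStage.distortionMeasure g hg with hν
  set L := ∫ α in Set.Ioc (0 : ℝ) 1, α ^ (-(1 / p)) ∂ν with hLdef
  set D := TwoStage.maxVertexNorm W q with hD
  have hL0 : 0 ≤ L := setIntegral_nonneg measurableSet_Ioc fun α hα => Real.rpow_nonneg hα.1.le _
  have hD0 : 0 ≤ D := TwoStage.maxVertexNorm_nonneg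
  have hĥ := TwoStage.convexOn_hHat hXconv hh hfin
  have hobj : ∀ μ, TwoStage.HasMoment p μ → ConvexOn ℝ (T '' X) fun x =>
      TwoStage.hHat X h T x + TwoStage.mixedCvar W q ν x μ := fun μ hμ =>
    hĥ.add ((TwoStage.convexOn_mixedCvar hW hq hp hμ hL).subset (subset_univ _) hĥ.1)
  have hobjlsc : ∀ μ, TwoStage.HasMoment p μ → LowerSemicontinuousOn (fun x =>
      TwoStage.hHat X h T x + TwoStage.mixedCvar W q ν x μ) (T '' X) := fun μ hμ =>
    hlsc.add (TwoStage.continuous_mixedCvar hW hq hp hμ hL).continuousOn.lowerSemicontinuousOn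
  obtain ⟨x₀, hx₀, hx₀V⟩ := hV
  obtain ⟨ρ, hρ, hρV⟩ := Metric.nhds_basis_closedBall.mem_iff.1 (hVopen.mem_nhds hx₀V)
  have hgrowth : ∀ x ∈ T '' X, x ∈ Metric.closedBall x₀ ρ →
      TwoStage.hHat X h T x₀ + TwoStage.mixedCvar W q ν x₀ μ₀ + κ / 2 * ‖x - x₀‖ ^ 2 ≤
        TwoStage.hHat X h T x + TwoStage.mixedCvar W q ν x μ₀ := fun x hx hxρ =>
    TwoStage.quadratic_growth_of_strongConvexOn hĥ hsc hx₀.1 hx₀V hx₀.2 hx (hρV hxρ)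
  have hstab := fun μ hμ (ε : ℝ) => TwoStage.minimizers_of_quadratic_growth (ε := ε)
    (F₀ := fun x => TwoStage.hHat X h T x + TwoStage.mixedCvar W q ν x μ₀) hTX
    (hobj μ hμ) (hobjlsc μ hμ) hx₀.1 hρ hκ hgrowth
  -- The stability estimate for `μ₀` against itself, with `ε = 0`, gives uniqueness.
  have huniq : TwoStage.solutionSet W q X h T ν μ₀ = {x₀} := by
    refine eq_singleton_iff_unique_mem.2 ⟨hx₀, fun x hx => ?_⟩
    have h1 := (hstab μ₀ hμ₀ 0 (fun x _ => by simp) (by rw [mul_zero]; positivity)).2 x hx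
    rw [zero_div, Real.sqrt_zero, mul_zero] at h1
    exact sub_eq_zero.1 (norm_le_zero_iff.1 h1)
  -- This radius forces `4 * (L * D * d) < κ * ρ ^ 2`; the summand `1` covers `L * D = 0`.
  refine ⟨κ * ρ ^ 2 / (8 * (L * D + 1)), by positivity, fun μ hμ hdist => ?_⟩
  set d := (TwoStage.wasserstein p μ₀ μ).toReal with hd
  have hfinite : TwoStage.wasserstein p μ₀ μ ≠ ⊤ := ne_top_of_le_ne_top ENNReal.ofReal_ne_top hdist
  have hd0 : 0 ≤ d := ENNReal.toReal_nonneg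
  have hdr : d ≤ κ * ρ ^ 2 / (8 * (L * D + 1)) :=
    ENNReal.toReal_le_of_le_ofReal (by positivity) hdist
  have hsmall : 4 * (L * (D * d)) < κ * ρ ^ 2 := by
    rw [le_div_iff₀ (by positivity)] at hdr
    have h1 : 0 < κ * ρ ^ 2 := by positivity
    have h2 : 0 ≤ L * (D * d) := by positivity
    linarith
  obtain ⟨hne, hnear⟩ := hstab μ hμ (L * (D * d)) (fun x _ => by
    rw [add_sub_add_left_eq_sub]
    exact TwoStage.abs_mixedCvar_sub_le hW hq hp hμ₀ hμ hL hfinite x) hsmall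
  have hrate : L * (D * d) / κ = L * D / κ * d := by ring
  rw [hrate] at hnear
  refine ⟨hne, ?_⟩
  have hedist : ∀ x ∈ TwoStage.solutionSet W q X h T ν μ,
      edist x x₀ ≤ ENNReal.ofReal (2 * √(L * D / κ * d)) := fun x hx => by
    rw [edist_dist, dist_eq_norm]
    exact ENNReal.ofReal_le_ofReal (hnear x hx)
  rw [huniq]
  -- One of the two sets is `{x₀}`, so the distance bound for all perturbed minimisers and the
  -- existence of one of them settle both inclusions.
  refine Metric.hausdorffEDist_le_of_mem_edist ?_ fun x hx => ⟨x₀, rfl, hedist x hx⟩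
  rintro _ rfl
  obtain ⟨x, hx⟩ := hne
  exact ⟨x, hx, by rw [edist_comm]; exact hedist x hx⟩
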